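/- **Setting.** Let $\mathcal H$ be a finite set of (measurable) classifiers $\mathcal X\to\{\pm1\}$, $\mathcal D$ a probability distribution on $\mathcal X\times\{\pm1\}$, $\mathrm{err}(h)=\Pr_{(X,Y)\sim\mathcal D}(h(X)\ne Y)$, $h^*\in\arg\min_{h\in\mathcal H}\mathrm{err}(h)$, and $\mathrm{reg}(h,h')=\mathrm{err}(h)-\mathrm{err}(h')$. For a multiset $S$ of weighted labeled examples put $\mathrm{err}(h,S)=\frac1{|S|}\sum_{(x,y,w)\in S}w\,\mathbf 1(h(x)\ne y)$ and $\mathrm{reg}(h,h',S)=\mathrm{err}(h,S)-\mathrm{err}(h',S)$. For $A\subseteq\mathcal H$ let $\mathrm{DIS}(A)=\{x:\exists h,h'\in A,\ h(x)\neq h'(x)\}$. **Algorithm (Active Cover).** Fix an epoch schedule $0=\tau_0<3=\tau_1<\tau_2<\dots<\tau_M=n$ of integers with $M\ge 1$ and $\tau_{m+1}\le 2\tau_m$ for $m\ge1$. Let $\epsilon_m=32\,(\log(|\mathcal H|/\delta)+\log\tau_m)/\tau_m$. The real constants satisfy $$\alpha\ge1,\quad \eta\ge864,\quad \xi\le\frac1{8n\epsilon_M\log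 n},\quad \beta^2\le\frac{\eta}{864\gamma n\epsilon_M\log n},\quad \gamma\ge\frac\eta4,\quad c_1\ge2\alpha\sqrt6,\quad c_2\ge\frac{\eta c_1^2}{4},\quad c_3\ge1 .$$ Examples $(X_1,Y_1),\dots,(X_n,Y_n)$ are i.i.d. from $\mathcal D$. Start with $\tilde Z_0=\emptyset$, $A_1=\mathcal H$; epoch $m$ consists of the indices $\tau_{m-1}<i\le\tau_m$, and $D_m=\mathrm{DIS}(A_m)$. In epoch $1$ all labels are queried, and $(X_i,Y_i,1)$ is added to the sample. In epoch $m\ge2$: if $X_i\in D_m$, draw $Q_i\sim\mathrm{Bernoulli}(P_m(X_i))$, and add $(X_i,Y_i,1/P_m(X_i))$ if $Q_i=1$ and $(X_i,1,0)$ if $Q_i=0$; if $X_i\notin D_m$, add $(X_i,h_m(X_i),1)$. Let $\tilde Z_m$ be the sample after epoch $m$. For $1\le m\le M$ put $$h_{m+1}\in\arg\min_{h\in\mathcal H}\mathrm{err}(h,\tilde Z_m),\qquad \Delta_m=c_1\sqrt{\epsilon_m\,\mathrm{err}(h_{m+1},\tilde Z_m)}+c_2\epsilon_m\log\tau_m,$$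 $$A_{m+1}=\{h\in\mathcal H:\ \mathrm{err}(h,\tilde Z_m)-\mathrm{err}(h_{m+1},\tilde Z_m)\le\gamma\Delta_m\}.$$ For $2\le m\le M$, $P_m$ minimizes $\mathbb E_X[1/(1-P(X))]$ over measurable $P:\mathcal X\to[0,1]$ such that $P(x)\ge P_{\min,m}$ for all $x\in D_m$ and, for every $h\in\mathcal H$, with $I_h(x)=\mathbf 1(h(x)\ne h_m(x)\wedge x\in D_m)$, $$\mathbb E_X\!\left[\frac{I_h(X)}{P(X)}\right]\le 2\alpha^2\,\mathbb E_X[I_h(X)]+2\beta^2\gamma\,\mathrm{reg}(h,h_m,\tilde Z_{m-1})\,\tau_{m-1}\Delta_{m-1}+\xi\,\tau_{m-1}\Delta_{m-1}^2,$$ where $$P_{\min,m}=\min\Big(c_3\Big/\Big(\sqrt{\tfrac{\tau_{m-1}\mathrm{err}(h_m,\tilde Z_{m-1})}{n\epsilon_M}}+\log\tau_{m-1}\Big),\ \tfrac12\Big).$$ The population threshold is, for $1\le m\le M$, $$\Delta^*_m=c_1\sqrt{\epsilon_m\,\overline{\mathrm{err}}_m(h^*)}+c_2\epsilon_m\log\tau_m,\qquad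 \overline{\mathrm{err}}_m(h)=\frac1{\tau_m}\sum_{j=1}^m(\tau_j-\tau_{j-1})\Pr_{(X,Y)\sim\mathcal D}\big(h(X)\ne Y\wedge X\in D_j\big),$$ the probability being taken for fixed $D_j$. **Corollary (realizable case).** Let $0<\delta<1/e$ with $|\mathcal H|/\delta>\sqrt{192}$, and suppose that $\mathrm{err}(h^*)=0$. Then with probability at least $1-\delta$, simultaneously for all $m=1,\dots,M$, $$\Delta_m=\Delta^*_m=c_2\,\epsilon_m\log\tau_m\qquad\text{and}\qquad \mathrm{reg}(h,h^*)\le16\,\gamma\,c_2\,\epsilon_m\log\tau_m\quad\text{for all }h\in A_{m+1}.$$ Thus every $h\in A_{m+1}$ has regret $\tilde O(1/\tau_m)$, explicitly at most $512\,\gamma c_2\,(\log(|\mathcal H|/\delta)+\log\tau_m)\log\tau_m/\tau_m$. -/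

import Mathlib

open MeasureTheory ProbabilityTheory

namespace ActiveCover

/-- The two labels `±1` are the two elements of `Bool`. A sample is a multiset of
importance weighted labeled examples `(x, y, w)`. -/
abbrev Sample (𝒳 : Type*) := Multiset (𝒳 × Bool × ℝ)

/-- `err(h) = Pr_{(X,Y) ∼ D}(h(X) ≠ Y)`. -/
noncomputable def err {𝒳 : Type*} [MeasurableSpace 𝒳] (D : Measure (𝒳 × Bool))
    (h : 𝒳 → Bool) : ℝ :=
  D.real {z | h z.1 ≠ z.2}

/-- `reg(h, h') = err(h) - err(h')`. -/
noncomputable def reg {𝒳 : Type*} [MeasurableSpace 𝒳] (D : Measure (𝒳 × Bool))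
    (h h' : 𝒳 → Bool) : ℝ :=
  err D h - err D h'

/-- `err(h, S) = ∑_{(x,y,w) ∈ S} w · 1(h(x) ≠ y) / |S|`. -/
noncomputable def empErr {𝒳 : Type*} (h : 𝒳 → Bool) (S : Sample 𝒳) : ℝ :=
  (S.map fun e => if h e.1 ≠ e.2.1 then e.2.2 else 0).sum / (S.card : ℝ)

/-- `reg(h, h', S) = err(h, S) - err(h', S)`. -/
noncomputable def empReg {𝒳 : Type*} (h h' : 𝒳 → Bool) (S : Sample 𝒳) : ℝ :=
  empErr h S - empErr h' S

/-- The disagreement region of a set of classifiers. -/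
def DIS {𝒳 : Type*} (A : Set (𝒳 → Bool)) : Set 𝒳 :=
  {x | ∃ h ∈ A, ∃ h' ∈ A, h x ≠ h' x}

/-- The input parameters of the algorithm: real constants, number `M` of epochs and epoch
schedule `τ`; the number of unlabeled examples is `n = τ M`. -/
structure Params where
  c₁ : ℝ
  c₂ : ℝ
  c₃ : ℝ
  α : ℝ
  β : ℝ
  γ : ℝ
  ξ : ℝ
  η : ℝ
  δ : ℝ
  M : ℕ
  τ : ℕ → ℕ

/-- The number of examples in the stream. -/
def Params.n (p : Params) : ℕ := p.τ p.M

/-- `ε_m = 32 (log(|H|/δ) + log τ_m) / τ_m`, with `N = |H|`. -/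
noncomputable def Params.eps (p : Params) (N m : ℕ) : ℝ :=
  32 * (Real.log (N / p.δ) + Real.log (p.τ m)) / p.τ m

/-- `Δ_0 = c₁ √ε_1 + c₂ ε_1 log 3`. -/
noncomputable def Params.Delta0 (p : Params) (N : ℕ) : ℝ :=
  p.c₁ * √(p.eps N 1) + p.c₂ * p.eps N 1 * Real.log 3

/-- The epoch schedule: `0 = τ_0 < 3 = τ_1 < τ_2 < ⋯ < τ_M` and `τ_{m+1} ≤ 2 τ_m` for
`m ≥ 1`. -/
structure Params.ValidSchedule (p : Params) : Prop where
  one_le_M : 1 ≤ p.M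
  tau_zero : p.τ 0 = 0
  tau_one : p.τ 1 = 3
  lt_succ : ∀ m, m < p.M → p.τ m < p.τ (m + 1)
  succ_le : ∀ m, 1 ≤ m → m < p.M → p.τ (m + 1) ≤ 2 * p.τ m

/-- The conditions on the constants, with `N = |H|`. -/
structure Params.ValidConstants (p : Params) (N : ℕ) : Prop where
  alpha_ge : 1 ≤ p.α
  eta_ge : 864 ≤ p.η
  xi_le : p.ξ ≤ 1 / (8 * p.n * p.eps N p.M * Real.log p.n)
  beta_le : p.β ^ 2 ≤ p.η / (864 * p.γ * p.n * p.eps N p.M * Real.log p.n)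
  gamma_ge : p.η / 4 ≤ p.γ
  c₁_ge : 2 * p.α * √6 ≤ p.c₁
  c₂_ge : p.η * p.c₁ ^ 2 / 4 ≤ p.c₂
  c₃_ge : 1 ≤ p.c₃

/-- One realization of everything that enters an execution of the algorithm: the examples
`(x i, y i)` and the query bits `q i` for `i = 1, …, n`, the empirical error minimizers `h m`
and the query probability functions `P m`. -/
structure Trace (𝒳 : Type*) where
  x : ℕ → 𝒳
  y : ℕ → Bool
  q : ℕ → Bool
  h : ℕ → 𝒳 → Bool
  P : ℕ → 𝒳 → ℝ

open scoped Classical in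
/-- The weighted example that the algorithm adds for the `i`-th data point, in epoch `m` with
disagreement region `R`. In the first epoch all labels are queried. -/
noncomputable def Trace.addedExample {𝒳 : Type*} (t : Trace 𝒳) (m : ℕ) (R : Set 𝒳) (i : ℕ) :
    𝒳 × Bool × ℝ :=
  if m = 1 then (t.x i, t.y i, 1)
  else if t.x i ∈ R then
    if t.q i = true then (t.x i, t.y i, 1 / t.P m (t.x i)) else (t.x i, true, 0)
  else (t.x i, t.h m (t.x i), 1)

/-- The threshold `Δ_m`, `m ≥ 1`, as a function of `e = err(h_{m+1}, Z̃_m)`. -/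
noncomputable def Params.threshold (p : Params) (N m : ℕ) (e : ℝ) : ℝ :=
  p.c₁ * √(p.eps N m * e) + p.c₂ * p.eps N m * Real.log (p.τ m)

/-- The pair `(Z̃_m, A_{m+1})`, starting from `Z̃_0 = ∅` and `A_1 = H`. -/
noncomputable def state {𝒳 : Type*} (p : Params) (H : Finset (𝒳 → Bool)) (t : Trace 𝒳) :
    ℕ → Sample 𝒳 × Set (𝒳 → Bool)
  | 0 => (0, {g | g ∈ H})
  | m + 1 =>
    let Z : Sample 𝒳 := (state p H t m).1 +
      (Finset.Ioc (p.τ m) (p.τ (m + 1))).val.map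
        (t.addedExample (m + 1) (DIS (state p H t m).2))
    (Z, {g | g ∈ H ∧ empErr g Z - empErr (t.h (m + 2)) Z ≤
      p.γ * p.threshold H.card (m + 1) (empErr (t.h (m + 2)) Z)})

/-- The sample `Z̃_m` at the end of epoch `m`. -/
noncomputable def Ztilde {𝒳 : Type*} (p : Params) (H : Finset (𝒳 → Bool)) (t : Trace 𝒳)
    (m : ℕ) : Sample 𝒳 :=
  (state p H t m).1

/-- The set `A_m` of good classifiers of epoch `m ≥ 1`. -/
noncomputable def goodSet {𝒳 : Type*} (p : Params) (H : Finset (𝒳 → Bool)) (t : Trace 𝒳)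
    (m : ℕ) : Set (𝒳 → Bool) :=
  (state p H t (m - 1)).2

/-- The region `D_m = DIS(A_m)`. -/
noncomputable def region {𝒳 : Type*} (p : Params) (H : Finset (𝒳 → Bool)) (t : Trace 𝒳)
    (m : ℕ) : Set 𝒳 :=
  DIS (goodSet p H t m)

/-- The threshold `Δ_m`. -/
noncomputable def Delta {𝒳 : Type*} (p : Params) (H : Finset (𝒳 → Bool)) (t : Trace 𝒳)
    (m : ℕ) : ℝ :=
  if m = 0 then p.Delta0 H.card
  else p.threshold H.card m (empErr (t.h (m + 1)) (Ztilde p H t m))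

/-- `(1/τ_m) ∑_{j=1}^m (τ_j - τ_{j-1}) E_{(X,Y) ∼ D}[1(g(X) ≠ Y ∧ X ∈ D_j)]`. -/
noncomputable def errAvg {𝒳 : Type*} [MeasurableSpace 𝒳] (D : Measure (𝒳 × Bool))
    (p : Params) (H : Finset (𝒳 → Bool)) (t : Trace 𝒳) (m : ℕ) (g : 𝒳 → Bool) : ℝ :=
  (1 / (p.τ m : ℝ)) * ∑ j ∈ Finset.Icc 1 m,
    ((p.τ j : ℝ) - (p.τ (j - 1) : ℝ)) * D.real {z | g z.1 ≠ z.2 ∧ z.1 ∈ region p H t j}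

/-- The population threshold `Δ*_m`; `g` is the error minimizer `h*`. -/
noncomputable def DeltaStar {𝒳 : Type*} [MeasurableSpace 𝒳] (D : Measure (𝒳 × Bool))
    (p : Params) (H : Finset (𝒳 → Bool)) (t : Trace 𝒳) (g : 𝒳 → Bool) (m : ℕ) : ℝ :=
  if m = 0 then p.Delta0 H.card
  else p.c₁ * √(p.eps H.card m * errAvg D p H t m g) +
    p.c₂ * p.eps H.card m * Real.log (p.τ m)

/-- The minimum query probability `P_{min,m}`. -/
noncomputable def Pmin {𝒳 : Type*} (p : Params) (H : Finset (𝒳 → Bool)) (t : Trace 𝒳)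
    (m : ℕ) : ℝ :=
  min (p.c₃ / (√(p.τ (m - 1) * empErr (t.h m) (Ztilde p H t (m - 1)) /
      (p.n * p.eps H.card p.M)) + Real.log (p.τ (m - 1)))) (1 / 2)

/-- The set of `x` with `h(x) ≠ h_m(x)` and `x ∈ D_m`. -/
noncomputable def disSet {𝒳 : Type*} (p : Params) (H : Finset (𝒳 → Bool)) (t : Trace 𝒳)
    (m : ℕ) (g : 𝒳 → Bool) : Set 𝒳 :=
  {x | g x ≠ t.h m x ∧ x ∈ region p H t m}

/-- The right hand side `b_m(h)` of the variance constraints. -/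
noncomputable def bound {𝒳 : Type*} [MeasurableSpace 𝒳] (D : Measure (𝒳 × Bool))
    (p : Params) (H : Finset (𝒳 → Bool)) (t : Trace 𝒳) (m : ℕ) (g : 𝒳 → Bool) : ℝ :=
  2 * p.α ^ 2 * D.fst.real (disSet p H t m g) +
    2 * p.β ^ 2 * p.γ * empReg g (t.h m) (Ztilde p H t (m - 1)) * p.τ (m - 1) *
      Delta p H t (m - 1) +
    p.ξ * p.τ (m - 1) * Delta p H t (m - 1) ^ 2

/-- Feasibility of a (measurable) query probability function in the optimization problem of epoch `m`. -/
structure Feasible {𝒳 : Type*} [MeasurableSpace 𝒳] (D : Measure (𝒳 × Bool))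
    (p : Params) (H : Finset (𝒳 → Bool)) (t : Trace 𝒳) (m : ℕ) (P : 𝒳 → ℝ) : Prop where
  measurable : Measurable P
  variance : ∀ g ∈ H,
    ∫ x, (disSet p H t m g).indicator (fun x => 1 / P x) x ∂D.fst ≤ bound D p H t m g
  nonneg : ∀ x, 0 ≤ P x
  le_one : ∀ x, P x ≤ 1
  ge_min : ∀ x ∈ region p H t m, Pmin p H t m ≤ P x

/-- The objective `E_X[1 / (1 - P(X))]`, with value `∞` allowed. -/
noncomputable def objective {𝒳 : Type*} [MeasurableSpace 𝒳] (D : Measure (𝒳 × Bool))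
    (P : 𝒳 → ℝ) : ENNReal :=
  ∫⁻ x, (ENNReal.ofReal (1 - P x))⁻¹ ∂D.fst

/-- `P` solves the optimization problem of epoch `m`. -/
def IsSolution {𝒳 : Type*} [MeasurableSpace 𝒳] (D : Measure (𝒳 × Bool))
    (p : Params) (H : Finset (𝒳 → Bool)) (t : Trace 𝒳) (m : ℕ) (P : 𝒳 → ℝ) : Prop :=
  Feasible D p H t m P ∧ ∀ P', Feasible D p H t m P' → objective D P ≤ objective D P'

/-- `T` is a random execution of the algorithm on an i.i.d. stream from `D`. The filtration
`ℱ i` is the information available after `i` examples; it may contain the internal randomness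
used to break ties between empirical error minimizers and to select a solution of the
optimization problem. -/
structure IsRun {𝒳 Ω : Type*} [MeasurableSpace 𝒳] {mΩ : MeasurableSpace Ω}
    (μ : Measure Ω) (ℱ : Filtration ℕ mΩ) (D : Measure (𝒳 × Bool))
    (p : Params) (H : Finset (𝒳 → Bool)) (T : Ω → Trace 𝒳) : Prop where
  /-- The examples and query bits are revealed one at a time. -/
  measurable_xy : ∀ i, 1 ≤ i → i ≤ p.n → Measurable[ℱ i] fun ω => ((T ω).x i, (T ω).y i)
  measurable_q : ∀ i, 1 ≤ i → i ≤ p.n → Measurable[ℱ i] fun ω => (T ω).q i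
  /-- The examples are i.i.d. from `D`. -/
  law_xy : ∀ i, 1 ≤ i → i ≤ p.n → μ.map (fun ω => ((T ω).x i, (T ω).y i)) = D
  indep_xy : ∀ i, 1 ≤ i → i ≤ p.n →
    Indep (MeasurableSpace.comap (fun ω => ((T ω).x i, (T ω).y i)) inferInstance)
      (ℱ (i - 1)) μ
  /-- `h_{m+1}` minimizes the empirical error on `Z̃_m` and is known after `τ_m` examples. -/
  erm_mem : ∀ m, 1 ≤ m → m ≤ p.M → ∀ ω, (T ω).h (m + 1) ∈ H
  erm_le : ∀ m, 1 ≤ m → m ≤ p.M → ∀ ω, ∀ g ∈ H,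
    empErr ((T ω).h (m + 1)) (Ztilde p H (T ω) m) ≤ empErr g (Ztilde p H (T ω) m)
  erm_measurable : ∀ m, 1 ≤ m → m ≤ p.M → ∀ g ∈ H,
    MeasurableSet[ℱ (p.τ m)] {ω | (T ω).h (m + 1) = g}
  /-- `P_{m+1}` solves the optimization problem and is known after `τ_m` examples. -/
  solution : ∀ m, 1 ≤ m → m < p.M → ∀ ω, IsSolution D p H (T ω) (m + 1) ((T ω).P (m + 1))
  solution_measurable : ∀ m, 1 ≤ m → m < p.M →
    Measurable[(ℱ (p.τ m)).prod inferInstance] fun z : Ω × 𝒳 => (T z.1).P (m + 1) z.2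
  /-- If `X_i ∈ D_{m+1}` then the query bit is a `Bernoulli(P_{m+1}(X_i))` draw given the past
  and the current example; otherwise there is no query. -/
  query : ∀ m, 1 ≤ m → m < p.M → ∀ i, p.τ m < i → i ≤ p.τ (m + 1) →
    μ[{ω | (T ω).q i = true}.indicator (fun _ => (1 : ℝ)) |
        ℱ (i - 1) ⊔ MeasurableSpace.comap (fun ω => ((T ω).x i, (T ω).y i)) inferInstance]
      =ᵐ[μ] {ω | (T ω).x i ∈ region p H (T ω) (m + 1)}.indicator
        (fun ω => (T ω).P (m + 1) ((T ω).x i))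

end ActiveCover

open ActiveCover

/-! Almost surely every label equals `hstar (X_i)`. On such a trace the algorithm behaves
deterministically well (`IsRealizable.invariant`): `hstar` and `h_m` stay in `A_m`, so they agree
off `D_m`. Imputed labels are therefore correct, and the empirical minimizer has weighted error
exactly 0. This settles both thresholds. It also reduces `Pmin` to `min (c₃ / log τ_{m-1}) (1/2)`,
so the importance weights up to epoch `m` are at most `2 log τ_m` (`IsRealizable.le_Pmin`).

For a fixed classifier `g`, its empirical error is then an average of importance weighted indicators
of true mistakes (`empErr_Ztilde_eq`). Such sums satisfy a one-sided Chernoff bound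
(`measure_sum_weightedIndicator_le`): with `c = 1 / (2 log τ_m)`, the scaled weights lie in `[0,
1]`, where `1 - exp (-t) ≥ t / 2`, so each example multiplies the exponential moment by at most `1 -
c * err g / 2`.

A classifier in `A_{m+1}` has empirical error at most `γ c₂ ε_m log τ_m`. If its true error exceeds
16 times this value, the tail is at most `δ / (|H| τ_m²)` (`exp_tail_le`). A union bound over `H`
and the epochs costs at most `δ`, since `∑ τ_m⁻² ≤ 1`. -/

theorem half_le_one_sub_exp_neg {t : ℝ} (h0 : 0 ≤ t) (h1 : t ≤ 1) :
    t / 2 ≤ 1 - Real.exp (-t) := by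
  have h : Real.exp (-t) ≤ (1 + t)⁻¹ := by
    rw [Real.exp_neg]
    exact inv_anti₀ (by linarith) (by linarith [Real.add_one_le_exp t])
  have h2 : (1 + t)⁻¹ ≤ 1 - t / 2 := by
    rw [inv_le_iff_one_le_mul₀ (by linarith)]
    nlinarith
  linarith

/-- The importance weighted indicator of `A`: weight `1` where no query is made (`p = 0`), and
weight `1_Q / p` where `Q` is queried with probability `p ≠ 0`. -/
noncomputable def weightedIndicator {Ω : Type*} (A Q : Set Ω) (p : Ω → ℝ) : Ω → ℝ :=
  A.indicator fun ω => if p ω = 0 then 1 else Q.indicator (fun _ => (1 : ℝ)) ω / p ω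

/-! ### Exponential moments and lower tails of importance weighted sums. -/

section WeightedIndicator

variable {Ω : Type*} {mΩ : MeasurableSpace Ω}

theorem measurable_weightedIndicator {m : MeasurableSpace Ω} {A Q : Set Ω} {p : Ω → ℝ}
    (hA : MeasurableSet[m] A) (hQ : MeasurableSet[m] Q) (hp : Measurable[m] p) :
    Measurable[m] (weightedIndicator A Q p) := by
  refine Measurable.indicator (Measurable.ite (hp (measurableSet_singleton 0)) ?_ ?_) hA
  · exact measurable_const
  · exact (Measurable.indicator measurable_const hQ).div hp

/-- The exponential is affine in the indicator of `Q`, with coefficients depending only on `A` and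
`p`; this allows the query bit to be replaced by its conditional probability. -/
theorem exp_neg_weightedIndicator (A Q : Set Ω) (p : Ω → ℝ) (c : ℝ) (ω : Ω) :
    Real.exp (-(c * weightedIndicator A Q p ω)) =
      1 - A.indicator (fun ω => if p ω = 0 then 1 - Real.exp (-c) else 0) ω -
        A.indicator (fun ω => if p ω = 0 then 0 else 1 - Real.exp (-(c / p ω))) ω *
          Q.indicator (fun _ => (1 : ℝ)) ω := by
  by_cases hA : ω ∈ A <;> by_cases hp : p ω = 0 <;> by_cases hQ : ω ∈ Q <;>
    simp [weightedIndicator, hA, hp, hQ, div_eq_mul_inv]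

theorem integral_mul_condExp_eq {μ : Measure Ω} [IsProbabilityMeasure μ] {G : MeasurableSpace Ω}
    (hG : G ≤ mΩ) {f v : Ω → ℝ} (hf : Integrable f μ) (hv : Measurable[G] v) {C : ℝ}
    (hvC : ∀ᵐ ω ∂μ, ‖v ω‖ ≤ C) :
    ∫ ω, v ω * (μ[f | G]) ω ∂μ = ∫ ω, v ω * f ω ∂μ := by
  have hint : Integrable (v * f) μ :=
    hf.bdd_mul (hv.mono hG le_rfl).aestronglyMeasurable hvC
  have h := condExp_mul_of_stronglyMeasurable_left hv.stronglyMeasurable hint hf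
  rw [← integral_condExp hG (f := fun ω => v ω * f ω)]
  exact (integral_congr_ae h).symm

/-- One step of the Chernoff argument. Averaging out the query bit leaves `1 - u - v * p`. On `A`
the loss is `1 - exp (-c)` or `(1 - exp (-(c / p))) * p`, both at least `c / 2`. The factor `F`
carries the past. -/
theorem integral_mul_exp_neg_weightedIndicator_le {μ : Measure Ω} [IsProbabilityMeasure μ]
    {G : MeasurableSpace Ω} (hG : G ≤ mΩ) {A Q : Set Ω} (hA : MeasurableSet[G] A)
    (hQ : MeasurableSet[mΩ] Q) {p : Ω → ℝ} (hpm : Measurable[G] p)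
    (hp : p = 0 ∨ p = μ[Q.indicator (fun _ => (1 : ℝ)) | G]) {c : ℝ} (hc0 : 0 < c) (hc1 : c ≤ 1)
    (hpc : ∀ᵐ ω ∂μ, p ω = 0 ∨ c ≤ p ω) {F : Ω → ℝ} (hF : Measurable[G] F)
    (hF0 : ∀ᵐ ω ∂μ, 0 ≤ F ω) (hF1 : ∀ᵐ ω ∂μ, F ω ≤ 1) :
    ∫ ω, F ω * Real.exp (-(c * weightedIndicator A Q p ω)) ∂μ ≤
      ∫ ω, F ω ∂μ - c / 2 * ∫ ω, F ω * A.indicator (fun _ => (1 : ℝ)) ω ∂μ := by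
  set u : Ω → ℝ := A.indicator (fun ω => if p ω = 0 then 1 - Real.exp (-c) else 0) with hu
  set v : Ω → ℝ := A.indicator (fun ω => if p ω = 0 then 0 else 1 - Real.exp (-(c / p ω))) with hv
  have hec : Real.exp (-c) ≤ 1 := Real.exp_le_one_iff.2 (by linarith)
  have hum : Measurable[G] u := Measurable.indicator
    (Measurable.ite (hpm (measurableSet_singleton 0)) measurable_const measurable_const) hA
  have hvm : Measurable[G] v := by
    refine Measurable.indicator
      (Measurable.ite (hpm (measurableSet_singleton 0)) measurable_const ?_) hA
    exact measurable_const.sub (Real.measurable_exp.comp (measurable_const.div hpm).neg)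
  have hu1 : ∀ ω, ‖u ω‖ ≤ 1 := by
    intro ω
    have := Real.exp_pos (-c)
    rw [Real.norm_eq_abs, abs_le, hu]
    by_cases h : ω ∈ A <;> by_cases h' : p ω = 0 <;> simp [h, h'] <;>
      exact ⟨by linarith, by linarith⟩
  have hv1 : ∀ᵐ ω ∂μ, ‖v ω‖ ≤ 1 := by
    filter_upwards [hpc] with ω hω
    rw [Real.norm_eq_abs, abs_le, hv]
    by_cases h : ω ∈ A <;> by_cases h' : p ω = 0
    · simp [h, h']
    · have hcp : 0 ≤ c / p ω := by
        rcases hω with h2 | h2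
        · exact absurd h2 h'
        · exact div_nonneg hc0.le (hc0.le.trans h2)
      have h1 : Real.exp (-(c / p ω)) ≤ 1 := Real.exp_le_one_iff.2 (by linarith)
      have := Real.exp_pos (-(c / p ω))
      simp only [h, h', Set.indicator_of_mem, if_false]
      constructor <;> linarith
    · simp [h]
    · simp [h]
  have hF1' : ∀ᵐ ω ∂μ, ‖F ω‖ ≤ 1 := by
    filter_upwards [hF0, hF1] with ω h0 h1
    rwa [Real.norm_eq_abs, abs_of_nonneg h0]
  have hFi : Integrable F μ :=
    Integrable.of_bound (hF.mono hG le_rfl).aestronglyMeasurable 1 hF1'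
  have hFu : Integrable (fun ω => F ω * u ω) μ :=
    hFi.mul_bdd (c := 1) (hum.mono hG le_rfl).aestronglyMeasurable (ae_of_all _ hu1)
  have hFv : Integrable (fun ω => F ω * v ω) μ :=
    hFi.mul_bdd (c := 1) (hvm.mono hG le_rfl).aestronglyMeasurable hv1
  have hQi : Integrable (Q.indicator (fun _ => (1 : ℝ))) μ :=
    (integrable_const (1 : ℝ)).indicator hQ
  have hFvb : ∀ᵐ ω ∂μ, ‖F ω * v ω‖ ≤ 1 := by
    filter_upwards [hv1, hF1'] with ω hω hω'
    rw [norm_mul]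
    exact mul_le_one₀ hω' (norm_nonneg _) hω
  have hFvm : Measurable[G] fun ω => F ω * v ω := hF.mul hvm
  have hFvQ : Integrable (fun ω => F ω * v ω * Q.indicator (fun _ => (1 : ℝ)) ω) μ :=
    hQi.bdd_mul (hFvm.mono hG le_rfl).aestronglyMeasurable hFvb
  have hpi : Integrable p μ := by
    rcases hp with h | h
    · rw [h]; exact integrable_zero _ _ _
    · rw [h]; exact integrable_condExp
  have hFvp : Integrable (fun ω => F ω * v ω * p ω) μ :=
    hpi.bdd_mul (hFvm.mono hG le_rfl).aestronglyMeasurable hFvb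
  -- If `p` is identically 0 then `v` vanishes, so no relation between `p` and `Q` is needed; this
  -- covers the first epoch.
  have hkey : ∫ ω, F ω * v ω * Q.indicator (fun _ => (1 : ℝ)) ω ∂μ = ∫ ω, F ω * v ω * p ω ∂μ := by
    rcases hp with h | h
    · refine integral_congr_ae (ae_of_all _ fun ω => ?_)
      by_cases hA' : ω ∈ A <;> simp [hv, h]
    · rw [h]
      exact (integral_mul_condExp_eq hG hQi hFvm hFvb).symm
  have hAi : Integrable (fun ω => F ω * A.indicator (fun _ => (1 : ℝ)) ω) μ := by
    refine hFi.mul_bdd (c := 1) (measurable_const.indicator (hG _ hA)).aestronglyMeasurable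
      (ae_of_all _ fun ω => ?_)
    by_cases h : ω ∈ A <;> simp [h]
  have hle : c / 2 * ∫ ω, F ω * A.indicator (fun _ => (1 : ℝ)) ω ∂μ ≤
      ∫ ω, F ω * u ω ∂μ + ∫ ω, F ω * v ω * p ω ∂μ := by
    rw [← integral_const_mul, ← integral_add hFu hFvp]
    refine integral_mono_ae (hAi.const_mul _) (hFu.add hFvp) ?_
    filter_upwards [hpc, hF0] with ω hω hω'
    have : c / 2 * A.indicator (fun _ => (1 : ℝ)) ω ≤ u ω + v ω * p ω := by
      by_cases h : ω ∈ A
      · by_cases h' : p ω = 0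
        · simpa [hu, hv, h, h'] using half_le_one_sub_exp_neg hc0.le hc1
        · have h2 : c ≤ p ω := hω.resolve_left h'
          have hp0 : 0 < p ω := hc0.trans_le h2
          have h3 := half_le_one_sub_exp_neg (div_nonneg hc0.le hp0.le) ((div_le_one hp0).2 h2)
          have h4 := mul_le_mul_of_nonneg_right h3 hp0.le
          have h5 : c / p ω / 2 * p ω = c / 2 := by field_simp
          simp only [hu, hv, h, h', Set.indicator_of_mem, if_false]
          linarith
      · simp [hu, hv, h]
    calc c / 2 * (F ω * A.indicator (fun _ => (1 : ℝ)) ω)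
        = F ω * (c / 2 * A.indicator (fun _ => (1 : ℝ)) ω) := by ring
      _ ≤ F ω * (u ω + v ω * p ω) := mul_le_mul_of_nonneg_left this hω'
      _ = F ω * u ω + F ω * v ω * p ω := by ring
  calc ∫ ω, F ω * Real.exp (-(c * weightedIndicator A Q p ω)) ∂μ
      = ∫ ω, (F ω - F ω * u ω - F ω * v ω * Q.indicator (fun _ => (1 : ℝ)) ω) ∂μ := by
        refine integral_congr_ae (ae_of_all _ fun ω => ?_)
        simp only [exp_neg_weightedIndicator, ← hu, ← hv]
        ring
    _ = ∫ ω, F ω ∂μ - ∫ ω, F ω * u ω ∂μ - ∫ ω, F ω * v ω * p ω ∂μ := by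
        rw [integral_sub (f := fun ω => F ω - F ω * u ω) (hFi.sub hFu) hFvQ, integral_sub hFi hFu, hkey]
    _ ≤ _ := by linarith

theorem weightedIndicator_nonneg {A Q : Set Ω} {p : Ω → ℝ} {ω : Ω} (hp : 0 ≤ p ω) :
    0 ≤ weightedIndicator A Q p ω := by
  by_cases hA : ω ∈ A <;> by_cases h : p ω = 0 <;> by_cases hQ : ω ∈ Q <;>
    simp [weightedIndicator, hA, h, hQ, hp]

/-- The exponential moment bound for a sum of importance weighted indicators of events of
probability `r`, each independent of the past. -/
theorem integral_exp_neg_sum_weightedIndicator_le {μ : Measure Ω} [IsProbabilityMeasure μ]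
    (ℱ : Filtration ℕ mΩ) {k : ℕ} {G 𝒜 : ℕ → MeasurableSpace Ω} {A Q : ℕ → Set Ω} {p : ℕ → Ω → ℝ}
    {c r : ℝ} (hc0 : 0 < c) (hc1 : c ≤ 1)
    (hpast : ∀ i, i + 1 ≤ k → ℱ i ≤ G (i + 1))
    (hfut : ∀ i, i + 1 ≤ k → G (i + 1) ≤ ℱ (i + 1))
    (hAG : ∀ i, i + 1 ≤ k → 𝒜 (i + 1) ≤ G (i + 1))
    (hA : ∀ i, i + 1 ≤ k → MeasurableSet[𝒜 (i + 1)] (A (i + 1)))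
    (hAr : ∀ i, i + 1 ≤ k → μ.real (A (i + 1)) = r)
    (hind : ∀ i, i + 1 ≤ k → Indep (𝒜 (i + 1)) (ℱ i) μ)
    (hQ : ∀ i, i + 1 ≤ k → MeasurableSet[ℱ (i + 1)] (Q (i + 1)))
    (hpm : ∀ i, i + 1 ≤ k → Measurable[G (i + 1)] (p (i + 1)))
    (hp : ∀ i, i + 1 ≤ k → p (i + 1) = 0 ∨
      p (i + 1) = μ[(Q (i + 1)).indicator (fun _ => (1 : ℝ)) | G (i + 1)])
    (hpc : ∀ i, i + 1 ≤ k → ∀ᵐ ω ∂μ, p (i + 1) ω = 0 ∨ c ≤ p (i + 1) ω)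
    (hr : r ≤ 1) :
    ∫ ω, Real.exp (-(c * ∑ i ∈ Finset.range k,
      weightedIndicator (A (i + 1)) (Q (i + 1)) (p (i + 1)) ω)) ∂μ ≤ (1 - c / 2 * r) ^ k := by
  set F : ℕ → Ω → ℝ := fun j ω => Real.exp (-(c * ∑ i ∈ Finset.range j,
      weightedIndicator (A (i + 1)) (Q (i + 1)) (p (i + 1)) ω)) with hF
  have hG : ∀ i, i + 1 ≤ k → G (i + 1) ≤ mΩ := fun i hi => (hfut i hi).trans (ℱ.le _)
  have hFm : ∀ j, j ≤ k → Measurable[ℱ j] (F j) := by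
    intro j hj
    refine Real.measurable_exp.comp (Measurable.neg (Measurable.const_mul ?_ c))
    refine Finset.measurable_fun_sum _ fun i hi => ?_
    have hi' : i + 1 ≤ j := Finset.mem_range.1 hi
    exact (measurable_weightedIndicator (hfut i (hi'.trans hj) _ (hAG i (hi'.trans hj) _
      (hA i (hi'.trans hj)))) (hQ i (hi'.trans hj))
      ((hpm i (hi'.trans hj)).mono (hfut i (hi'.trans hj)) le_rfl)).mono (ℱ.mono hi') le_rfl
  have hF0 : ∀ j ω, 0 ≤ F j ω := fun j ω => (Real.exp_pos _).le
  have hF1 : ∀ j, j ≤ k → ∀ᵐ ω ∂μ, F j ω ≤ 1 := by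
    intro j hj
    have : ∀ᵐ ω ∂μ, ∀ i : ℕ, i + 1 ≤ k → p (i + 1) ω = 0 ∨ c ≤ p (i + 1) ω :=
      ae_all_iff.2 fun i => by
        by_cases h : i + 1 ≤ k
        · simpa [h] using hpc i h
        · simp [h]
    filter_upwards [this] with ω hω
    refine Real.exp_le_one_iff.2 (neg_nonpos.2 (mul_nonneg hc0.le (Finset.sum_nonneg ?_)))
    intro i hi
    refine weightedIndicator_nonneg ?_
    rcases hω i ((Finset.mem_range.1 hi).trans_le hj) with h | h
    · exact h.ge
    · exact hc0.le.trans h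
  suffices h : ∀ j, j ≤ k → ∫ ω, F j ω ∂μ ≤ (1 - c / 2 * r) ^ j from h k le_rfl
  intro j
  induction j with
  | zero => intro _; simp [hF]
  | succ j ih =>
    intro hj
    have hstep : ∀ ω, F (j + 1) ω = F j ω *
        Real.exp (-(c * weightedIndicator (A (j + 1)) (Q (j + 1)) (p (j + 1)) ω)) := by
      intro ω
      simp only [hF, Finset.sum_range_succ, ← Real.exp_add]
      congr 1
      ring
    have hAm := hA j hj
    have hAm' : MeasurableSet (A (j + 1)) := hG j hj _ (hAG j hj _ hAm)
    have h1 := integral_mul_exp_neg_weightedIndicator_le (μ := μ) (hG j hj) (hAG j hj _ hAm)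
      (ℱ.le _ _ (hQ j hj)) (hpm j hj) (hp j hj) hc0 hc1 (hpc j hj)
      ((hFm j (by omega)).mono (hpast j hj) le_rfl) (ae_of_all _ (hF0 j)) (hF1 j (by omega))
    -- The past factor `F j` is independent of the new event, so the integral factors.
    have h2 : ∫ ω, F j ω * (A (j + 1)).indicator (fun _ => (1 : ℝ)) ω ∂μ = (∫ ω, F j ω ∂μ) * r := by
      have hi : IndepFun (F j) ((A (j + 1)).indicator (fun _ => (1 : ℝ))) μ := by
        rw [IndepFun_iff_Indep]
        refine indep_of_indep_of_le_left (indep_of_indep_of_le_right (hind j hj).symm ?_) ?_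
        · exact Measurable.comap_le (Measurable.indicator measurable_const hAm)
        · exact Measurable.comap_le (hFm j (by omega))
      have h3 := hi.integral_mul_eq_mul_integral
        ((hFm j (by omega)).mono (ℱ.le _) le_rfl).aestronglyMeasurable
        (measurable_const.indicator hAm').aestronglyMeasurable
      rw [integral_indicator_const _ hAm', hAr j hj, smul_eq_mul, mul_one] at h3
      exact h3
    rw [integral_congr_ae (ae_of_all _ hstep)]
    have h0 : 0 ≤ 1 - c / 2 * r := by
      have : c / 2 * r ≤ c / 2 * 1 := mul_le_mul_of_nonneg_left hr (by linarith)
      linarith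
    calc _ ≤ ∫ ω, F j ω ∂μ - c / 2 * ((∫ ω, F j ω ∂μ) * r) := by rw [← h2]; exact h1
      _ = (∫ ω, F j ω ∂μ) * (1 - c / 2 * r) := by ring
      _ ≤ (1 - c / 2 * r) ^ j * (1 - c / 2 * r) :=
        mul_le_mul_of_nonneg_right (ih (by omega)) h0
      _ = _ := (pow_succ _ _).symm

/-- The lower tail bound for a sum of importance weighted indicators. -/
theorem measure_sum_weightedIndicator_le {μ : Measure Ω} [IsProbabilityMeasure μ]
    (ℱ : Filtration ℕ mΩ) {k : ℕ} {G 𝒜 : ℕ → MeasurableSpace Ω} {A Q : ℕ → Set Ω} {p : ℕ → Ω → ℝ}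
    {c r : ℝ} (hc0 : 0 < c) (hc1 : c ≤ 1)
    (hpast : ∀ i, i + 1 ≤ k → ℱ i ≤ G (i + 1))
    (hfut : ∀ i, i + 1 ≤ k → G (i + 1) ≤ ℱ (i + 1))
    (hAG : ∀ i, i + 1 ≤ k → 𝒜 (i + 1) ≤ G (i + 1))
    (hA : ∀ i, i + 1 ≤ k → MeasurableSet[𝒜 (i + 1)] (A (i + 1)))
    (hAr : ∀ i, i + 1 ≤ k → μ.real (A (i + 1)) = r)
    (hind : ∀ i, i + 1 ≤ k → Indep (𝒜 (i + 1)) (ℱ i) μ)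
    (hQ : ∀ i, i + 1 ≤ k → MeasurableSet[ℱ (i + 1)] (Q (i + 1)))
    (hpm : ∀ i, i + 1 ≤ k → Measurable[G (i + 1)] (p (i + 1)))
    (hp : ∀ i, i + 1 ≤ k → p (i + 1) = 0 ∨
      p (i + 1) = μ[(Q (i + 1)).indicator (fun _ => (1 : ℝ)) | G (i + 1)])
    (hpc : ∀ i, i + 1 ≤ k → ∀ᵐ ω ∂μ, p (i + 1) ω = 0 ∨ c ≤ p (i + 1) ω)
    (hr : r ≤ 1) (s : ℝ) :
    MeasurableSet {ω | ∑ i ∈ Finset.range k,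
      weightedIndicator (A (i + 1)) (Q (i + 1)) (p (i + 1)) ω ≤ s} ∧
    μ.real {ω | ∑ i ∈ Finset.range k,
      weightedIndicator (A (i + 1)) (Q (i + 1)) (p (i + 1)) ω ≤ s} ≤
      Real.exp (c * s - c / 2 * r * k) := by
  set X : Ω → ℝ := fun ω => ∑ i ∈ Finset.range k,
      weightedIndicator (A (i + 1)) (Q (i + 1)) (p (i + 1)) ω with hX
  have hXm : Measurable X := by
    refine Finset.measurable_fun_sum _ fun i hi => ?_
    have hi' : i + 1 ≤ k := Finset.mem_range.1 hi
    exact (measurable_weightedIndicator (hfut i hi' _ (hAG i hi' _ (hA i hi'))) (hQ i hi')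
      ((hpm i hi').mono (hfut i hi') le_rfl)).mono (ℱ.le _) le_rfl
  have hX0 : ∀ᵐ ω ∂μ, 0 ≤ X ω := by
    have : ∀ᵐ ω ∂μ, ∀ i : ℕ, i + 1 ≤ k → p (i + 1) ω = 0 ∨ c ≤ p (i + 1) ω :=
      ae_all_iff.2 fun i => by
        by_cases h : i + 1 ≤ k
        · simpa [h] using hpc i h
        · simp [h]
    filter_upwards [this] with ω hω
    refine Finset.sum_nonneg fun i hi => weightedIndicator_nonneg ?_
    rcases hω i (Finset.mem_range.1 hi) with h | h
    · exact h.ge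
    · exact hc0.le.trans h
  refine ⟨measurableSet_le hXm measurable_const, ?_⟩
  have hint : Integrable (fun ω => Real.exp (-c * X ω)) μ := by
    refine Integrable.of_bound (Real.measurable_exp.comp (hXm.const_mul _)).aestronglyMeasurable 1 ?_
    filter_upwards [hX0] with ω hω
    rw [Real.norm_eq_abs, Real.abs_exp, Real.exp_le_one_iff]
    nlinarith
  -- Markov's inequality for `exp (-c X)`: a negative parameter gives the lower tail.
  have h1 := measure_le_le_exp_mul_mgf (μ := μ) (X := X) s (neg_nonpos.2 hc0.le) hint
  have h2 := integral_exp_neg_sum_weightedIndicator_le ℱ hc0 hc1 hpast hfut hAG hA hAr hind hQ hpm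
    hp hpc hr
  have h3 : mgf X μ (-c) ≤ (1 - c / 2 * r) ^ k := by
    simpa [mgf, neg_mul] using h2
  have h0 : 0 ≤ 1 - c / 2 * r := by
    have : c / 2 * r ≤ c / 2 * 1 := mul_le_mul_of_nonneg_left hr (by linarith)
    linarith
  have h4 : (1 - c / 2 * r) ^ k ≤ Real.exp (-(c / 2 * r * k)) := by
    have := pow_le_pow_left₀ h0 (Real.one_sub_le_exp_neg (c / 2 * r)) k
    rwa [← Real.exp_nat_mul, show (k : ℝ) * -(c / 2 * r) = -(c / 2 * r * k) by ring] at this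
  calc _ ≤ Real.exp (-(-c) * s) * mgf X μ (-c) := h1
    _ ≤ Real.exp (-(-c) * s) * Real.exp (-(c / 2 * r * k)) :=
      mul_le_mul_of_nonneg_left (h3.trans h4) (Real.exp_pos _).le
    _ = _ := by rw [← Real.exp_add]; congr 1; ring

end WeightedIndicator

/-! ### The epoch schedule. -/

namespace ActiveCover

theorem Params.ValidSchedule.mono {p : Params} (hτ : p.ValidSchedule) {a b : ℕ} (hab : a ≤ b)
    (hb : b ≤ p.M) : p.τ a ≤ p.τ b := by
  induction b, hab using Nat.le_induction with
  | base => exact le_rfl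
  | succ b _ ih => exact (ih (by omega)).trans (hτ.lt_succ b (by omega)).le

/-- A strictly increasing integer sequence starting at 3; the growth makes `∑ τ_m⁻²` at most 1. -/
theorem Params.ValidSchedule.add_two_le {p : Params} (hτ : p.ValidSchedule) {m : ℕ} (h1 : 1 ≤ m)
    (hm : m ≤ p.M) : m + 2 ≤ p.τ m := by
  induction m, h1 using Nat.le_induction with
  | base => exact hτ.tau_one.ge
  | succ m _ ih =>
    have := ih (by omega)
    have := hτ.lt_succ m (by omega)
    omega

theorem Params.ValidSchedule.exists_epoch {p : Params} (hτ : p.ValidSchedule) {m i : ℕ}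
    (hm : m ≤ p.M) (h0 : 0 < i) (hi : i ≤ p.τ m) :
    ∃ j, j < m ∧ p.τ j < i ∧ i ≤ p.τ (j + 1) := by
  induction m with
  | zero => rw [hτ.tau_zero] at hi; omega
  | succ m ih =>
    rcases le_or_gt i (p.τ m) with h | h
    · obtain ⟨j, hj, h⟩ := ih (by omega) h
      exact ⟨j, by omega, h⟩
    · exact ⟨m, by omega, h, hi⟩

/-- Holds because `e < 3 = τ_1`. It makes `1 / (2 log τ_m)` smaller than `1 / 2`, the other term in
`Pmin`. -/
theorem Params.ValidSchedule.one_lt_log {p : Params} (hτ : p.ValidSchedule) {m : ℕ} (h1 : 1 ≤ m)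
    (hm : m ≤ p.M) : 1 < Real.log (p.τ m) := by
  have h : (3 : ℝ) ≤ p.τ m := by exact_mod_cast (by have := hτ.add_two_le h1 hm; omega : 3 ≤ p.τ m)
  rw [Real.lt_log_iff_exp_lt (by linarith)]
  linarith [Real.exp_one_lt_d9]

/-! ### Deterministic behaviour on realizable traces. -/

section Realizable

variable {𝒳 : Type*} {p : Params} {H : Finset (𝒳 → Bool)} {t : Trace 𝒳}

theorem Ztilde_succ (m : ℕ) : Ztilde p H t (m + 1) = Ztilde p H t m +
    (Finset.Ioc (p.τ m) (p.τ (m + 1))).val.map (t.addedExample (m + 1) (region p H t (m + 1))) :=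
  rfl

theorem mem_goodSet_succ (m : ℕ) (g : 𝒳 → Bool) : g ∈ goodSet p H t (m + 2) ↔
    g ∈ H ∧ empErr g (Ztilde p H t (m + 1)) -
      empErr (t.h (m + 2)) (Ztilde p H t (m + 1)) ≤
      p.γ * p.threshold H.card (m + 1) (empErr (t.h (m + 2)) (Ztilde p H t (m + 1))) :=
  Iff.rfl

theorem card_Ztilde (hτ : p.ValidSchedule) {m : ℕ} (hm : m ≤ p.M) :
    (Ztilde p H t m).card = p.τ m := by
  induction m with
  | zero => simp [Ztilde, state, hτ.tau_zero]
  | succ m ih =>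
    have := hτ.lt_succ m (by omega)
    rw [Ztilde_succ, Multiset.card_add, ih (by omega), Multiset.card_map]
    change _ + (Finset.Ioc _ _).card = _
    rw [Nat.card_Ioc]
    omega

/-- The epochs tile the stream, so a sum over the sample becomes one over time. The stream starts at
index 1, whence the shift to `i + 1`. -/
theorem sum_map_Ztilde (hτ : p.ValidSchedule) {f : 𝒳 × Bool × ℝ → ℝ} {z : ℕ → ℝ} {m : ℕ}
    (hm : m ≤ p.M) (hz : ∀ j < m, ∀ i, p.τ j < i → i ≤ p.τ (j + 1) →
      f (t.addedExample (j + 1) (region p H t (j + 1)) i) = z i) :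
    ((Ztilde p H t m).map f).sum = ∑ i ∈ Finset.range (p.τ m), z (i + 1) := by
  induction m with
  | zero => simp [Ztilde, state, hτ.tau_zero]
  | succ m ih =>
    have hlt := (hτ.lt_succ m (by omega)).le
    rw [Ztilde_succ, Multiset.map_add, Multiset.sum_add,
      ih (by omega) fun j hj => hz j (by omega), Multiset.map_map,
      ← Finset.sum_range_add_sum_Ico _ hlt]
    congr 1
    rw [Finset.sum_Ico_add' z, Finset.Ico_add_one_add_one_eq_Ioc]
    refine Finset.sum_congr rfl fun i hi => ?_
    rw [Finset.mem_Ioc] at hi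
    exact hz m (by omega) i hi.1 hi.2

theorem empErr_nonneg {S : Sample 𝒳} (hS : ∀ e ∈ S, 0 ≤ e.2.2) (g : 𝒳 → Bool) :
    0 ≤ empErr g S := by
  refine div_nonneg (Multiset.sum_nonneg fun x hx => ?_) (Nat.cast_nonneg _)
  obtain ⟨e, he, rfl⟩ := Multiset.mem_map.1 hx
  split_ifs
  · exact hS e he
  · exact le_rfl

theorem empErr_eq_zero {S : Sample 𝒳} {g : 𝒳 → Bool}
    (hS : ∀ e ∈ S, g e.1 ≠ e.2.1 → e.2.2 = 0) : empErr g S = 0 := by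
  rw [empErr, Multiset.sum_eq_zero, zero_div]
  intro x hx
  obtain ⟨e, he, rfl⟩ := Multiset.mem_map.1 hx
  split_ifs with h
  · exact hS e he h
  · rfl

/-- A trace on which `hstar` makes no mistake. -/
structure IsRealizable (p : Params) (H : Finset (𝒳 → Bool)) (hstar : 𝒳 → Bool)
    (t : Trace 𝒳) : Prop where
  mem : hstar ∈ H
  label : ∀ i, 1 ≤ i → i ≤ p.n → t.y i = hstar (t.x i)
  erm_mem : ∀ m, 1 ≤ m → m ≤ p.M → t.h (m + 1) ∈ H
  erm_le : ∀ m, 1 ≤ m → m ≤ p.M → ∀ g ∈ H,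
    empErr (t.h (m + 1)) (Ztilde p H t m) ≤ empErr g (Ztilde p H t m)
  nonneg : ∀ m, 1 ≤ m → m < p.M → ∀ x, 0 ≤ t.P (m + 1) x
  threshold_nonneg : ∀ m, 1 ≤ m → m ≤ p.M → 0 ≤ p.γ * p.threshold H.card m 0

/-- The three claims feed each other: membership of `hstar` and the current minimizer in the good
set makes imputed labels correct, hence `hstar` has zero weighted error, hence so does the next
minimizer, and both pass the nonnegative threshold. -/
theorem IsRealizable.invariant {hstar : 𝒳 → Bool} (hτ : p.ValidSchedule)
    (ht : IsRealizable p H hstar t) {m : ℕ} (hm : m ≤ p.M) :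
    (∀ e ∈ Ztilde p H t m, 0 ≤ e.2.2 ∧ (hstar e.1 ≠ e.2.1 → e.2.2 = 0)) ∧
    hstar ∈ goodSet p H t (m + 1) ∧
    (1 ≤ m → t.h (m + 1) ∈ goodSet p H t (m + 1) ∧
      empErr (t.h (m + 1)) (Ztilde p H t m) = 0) := by
  induction m with
  | zero => exact ⟨by simp [Ztilde, state], ht.mem, by simp⟩
  | succ m ih =>
    obtain ⟨h1, h2, h3⟩ := ih (by omega)
    have hZ : ∀ e ∈ Ztilde p H t (m + 1), 0 ≤ e.2.2 ∧ (hstar e.1 ≠ e.2.1 → e.2.2 = 0) := by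
      intro e he
      rw [Ztilde_succ, Multiset.mem_add] at he
      rcases he with he | he
      · exact h1 e he
      obtain ⟨i, hi, rfl⟩ := Multiset.mem_map.1 he
      have hi : i ∈ Finset.Ioc (p.τ m) (p.τ (m + 1)) := hi
      rw [Finset.mem_Ioc] at hi
      have hy := ht.label i (by omega) (hi.2.trans (hτ.mono hm le_rfl))
      rw [Trace.addedExample]
      split_ifs with hm1 hR hq
      · simp [hy]
      · simpa [hy] using ht.nonneg m (by omega) (by omega) _
      · simp
      -- The label is imputed here. A disagreement between `hstar` and the minimizer, both good,
      -- would put the point in the disagreement region.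
      · refine ⟨zero_le_one, fun hne => absurd ?_ hne⟩
        by_contra hne'
        exact hR ⟨hstar, h2, _, (h3 (by omega)).1, hne'⟩
    have hs : empErr hstar (Ztilde p H t (m + 1)) = 0 := empErr_eq_zero fun e he => (hZ e he).2
    have he : empErr (t.h (m + 2)) (Ztilde p H t (m + 1)) = 0 :=
      le_antisymm (hs ▸ ht.erm_le (m + 1) (by omega) hm hstar ht.mem)
        (empErr_nonneg (fun e he => (hZ e he).1) _)
    have h0 := ht.threshold_nonneg (m + 1) (by omega) hm
    refine ⟨hZ, ?_, fun _ => ⟨?_, he⟩⟩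
    · rw [mem_goodSet_succ, he, hs, sub_zero]
      exact ⟨ht.mem, h0⟩
    · rw [mem_goodSet_succ, he, sub_zero]
      exact ⟨ht.erm_mem (m + 1) (by omega) hm, h0⟩

theorem IsRealizable.eq_of_notMem_region {hstar : 𝒳 → Bool} (hτ : p.ValidSchedule)
    (ht : IsRealizable p H hstar t) {m : ℕ} (h1 : 1 ≤ m) (hm : m ≤ p.M) {x : 𝒳}
    (hx : x ∉ region p H t (m + 1)) : t.h (m + 1) x = hstar x := by
  by_contra hne
  obtain ⟨_, h2, h3⟩ := ht.invariant hτ hm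
  exact hx ⟨_, (h3 h1).1, hstar, h2, hne⟩

/-- The zero error of the minimizer kills the square root in `Pmin`. The bound is stated with a
later `τ k` so that one constant serves all epochs up to `k`. -/
theorem IsRealizable.le_Pmin {hstar : 𝒳 → Bool} (hτ : p.ValidSchedule) (hc₃ : 1 ≤ p.c₃)
    (ht : IsRealizable p H hstar t) {m k : ℕ} (h1 : 1 ≤ m) (hm : m ≤ k) (hk : k ≤ p.M) :
    1 / (2 * Real.log (p.τ k)) ≤ Pmin p H t (m + 1) := by
  have he := ((ht.invariant hτ (hm.trans hk)).2.2 h1).2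
  have hlm := hτ.one_lt_log h1 (hm.trans hk)
  have hlk := hτ.one_lt_log (h1.trans hm) hk
  have hmk : Real.log (p.τ m) ≤ Real.log (p.τ k) :=
    Real.log_le_log (by exact_mod_cast (by have := hτ.add_two_le h1 (hm.trans hk); omega))
      (by exact_mod_cast hτ.mono hm hk)
  simp only [Pmin, Nat.add_sub_cancel, he, mul_zero, zero_div, Real.sqrt_zero, zero_add]
  refine le_min ?_ (one_div_le_one_div_of_le two_pos (by linarith))
  exact div_le_div₀ (by linarith) hc₃ (by linarith) (by linarith)

end Realizable

theorem isRealizable_of_isRun {𝒳 Ω : Type*} [MeasurableSpace 𝒳] {mΩ : MeasurableSpace Ω}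
    {μ : Measure Ω} {ℱ : Filtration ℕ mΩ} {D : Measure (𝒳 × Bool)} {H : Finset (𝒳 → Bool)}
    {p : Params} {hstar : 𝒳 → Bool} (hmem : hstar ∈ H)
    (hthr : ∀ m, 1 ≤ m → m ≤ p.M → 0 ≤ p.γ * p.threshold H.card m 0)
    {T : Ω → Trace 𝒳} (hT : IsRun μ ℱ D p H T) {ω : Ω}
    (hω : ∀ i, 1 ≤ i → i ≤ p.n → (T ω).y i = hstar ((T ω).x i)) :
    IsRealizable p H hstar (T ω) where
  mem := hmem
  label := hω
  erm_mem m h1 hm := hT.erm_mem m h1 hm ω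
  erm_le m h1 hm := hT.erm_le m h1 hm ω
  nonneg m h1 hm := (hT.solution m h1 hm ω).1.nonneg
  threshold_nonneg := hthr

/-! ### Numerical consequences of the choice of constants. -/

section Constants

variable {p : Params} {N : ℕ}

theorem Params.ValidConstants.one_le_gamma (hc : p.ValidConstants N) : 1 ≤ p.γ := by
  linarith [hc.eta_ge, hc.gamma_ge]

theorem Params.ValidConstants.one_le_c₂ (hc : p.ValidConstants N) : 1 ≤ p.c₂ := by
  have h6 : (1 : ℝ) ≤ √6 := Real.one_le_sqrt.2 (by norm_num)
  have hc₁ : 1 ≤ p.c₁ := by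
    refine le_trans ?_ hc.c₁_ge
    nlinarith [hc.alpha_ge, mul_nonneg (sub_nonneg.2 hc.alpha_ge) (sub_nonneg.2 h6)]
  have h1 : 1 ≤ p.c₁ ^ 2 := one_le_pow₀ hc₁
  nlinarith [hc.c₂_ge, hc.eta_ge]

theorem Params.eps_nonneg (hN : 0 ≤ Real.log (N / p.δ)) (m : ℕ) : 0 ≤ p.eps N m := by
  have := Real.log_natCast_nonneg (p.τ m)
  unfold Params.eps
  positivity

theorem Params.threshold_zero (m : ℕ) :
    p.threshold N m 0 = p.c₂ * p.eps N m * Real.log (p.τ m) := by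
  simp [Params.threshold]

theorem sum_inv_sq_le {τ : ℕ → ℕ} {M : ℕ} (hτ : ∀ m, 1 ≤ m → m ≤ M → m + 2 ≤ τ m) :
    ∑ m ∈ Finset.Icc 1 M, ((τ m : ℝ) ^ 2)⁻¹ ≤ 1 := by
  -- Telescoping: `τ_k⁻² ≤ 1 / (k (k + 1)) = 1 / k - 1 / (k + 1)`.
  have h : ∀ k ≤ M, ∑ m ∈ Finset.Icc 1 k, ((τ m : ℝ) ^ 2)⁻¹ ≤ 1 - 1 / (k + 1 : ℝ) := by
    intro k
    induction k with
    | zero => simp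
    | succ k ih =>
      intro hk
      rw [Finset.sum_Icc_succ_top (by omega)]
      have h1 := ih (by omega)
      have h2 : (k + 1 + 2 : ℝ) ≤ τ (k + 1) := by exact_mod_cast hτ (k + 1) (by omega) hk
      have h3 : ((τ (k + 1) : ℝ) ^ 2)⁻¹ ≤ 1 / ((k + 1 : ℝ) * (k + 1 + 1)) := by
        rw [inv_eq_one_div]
        exact one_div_le_one_div_of_le (by positivity) (by nlinarith)
      have h4 : 1 / ((k + 1 : ℝ) * (k + 1 + 1)) = 1 / (k + 1 : ℝ) - 1 / (k + 1 + 1 : ℝ) := by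
        field_simp
        ring
      push_cast
      linarith
  have := h M le_rfl
  have : 0 ≤ 1 / (M + 1 : ℝ) := by positivity
  linarith

/-- The tail probability of a classifier with large error, for the threshold of epoch `m`. -/
theorem exp_tail_le (hc : p.ValidConstants N) (hδ : 0 < p.δ) (hN0 : 0 < N)
    (hN : 0 ≤ Real.log (N / p.δ)) {m : ℕ} (hτm : 0 < p.τ m) (hlog : 1 < Real.log (p.τ m)) {r : ℝ}
    (hr : 16 * p.γ * p.c₂ * p.eps N m * Real.log (p.τ m) < r) :
    Real.exp (1 / (2 * Real.log (p.τ m)) *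
        (p.τ m * (p.γ * (p.c₂ * p.eps N m * Real.log (p.τ m)))) -
      1 / (2 * Real.log (p.τ m)) / 2 * r * p.τ m) ≤ p.δ / N * ((p.τ m : ℝ) ^ 2)⁻¹ := by
  set l := Real.log (p.τ m) with hl
  set L := Real.log (N / p.δ) with hL
  have ht : (0 : ℝ) < p.τ m := by exact_mod_cast hτm
  have heps : p.eps N m * p.τ m = 32 * (L + l) := by
    rw [Params.eps, div_mul_cancel₀ _ ht.ne']
  have hγc : 1 ≤ p.γ * p.c₂ := by nlinarith [hc.one_le_gamma, hc.one_le_c₂]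
  have hNr : (0 : ℝ) < N := by exact_mod_cast hN0
  have hrhs : p.δ / N * ((p.τ m : ℝ) ^ 2)⁻¹ = Real.exp (-(L + 2 * l)) := by
    rw [neg_add, Real.exp_add, hL, ← Real.log_inv, Real.exp_log (by positivity), Real.exp_neg,
      mul_comm 2 l, Real.exp_mul, hl, Real.exp_log ht, inv_div]
    norm_num
  rw [hrhs, Real.exp_le_exp]
  have h1 : 1 / (2 * l) / 2 * (16 * p.γ * p.c₂ * p.eps N m * l) * p.τ m ≤
      1 / (2 * l) / 2 * r * p.τ m := by gcongr
  have h2 : 1 / (2 * l) / 2 * (16 * p.γ * p.c₂ * p.eps N m * l) * p.τ m =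
      4 * (p.γ * p.c₂) * (p.eps N m * p.τ m) := by
    field_simp
    ring
  have h3 : 1 / (2 * l) * (p.τ m * (p.γ * (p.c₂ * p.eps N m * l))) =
      1 / 2 * (p.γ * p.c₂) * (p.eps N m * p.τ m) := by
    field_simp
  rw [heps] at h2 h3
  -- The exponent is at most `(1/2 - 4) * 32 * γ c₂ (L + l)`, and `γ c₂ ≥ 1`, which is far below the
  -- required `-(L + 2 l)`.
  nlinarith [mul_le_mul_of_nonneg_right hγc (by linarith : 0 ≤ L + l)]

end Constants

/-! ### From the algorithm's sample to sums of weighted indicators. -/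

section Run

/-- The value 0 of `v` encodes weight 1, in the first epoch and off the region. In the latter case
the imputed label is the true one, so the mistake can be counted against `y`. Positivity of `P` on
the region keeps this encoding unambiguous. -/
theorem IsRealizable.contribution_eq {𝒳 Ω : Type*} {p : Params} {H : Finset (𝒳 → Bool)} {T : Ω → Trace 𝒳}
    {ω : Ω} {hstar : 𝒳 → Bool} (hτ : p.ValidSchedule) (ht : IsRealizable p H hstar (T ω))
    {j i : ℕ} (hj : j < p.M) (h1 : p.τ j < i) (h2 : i ≤ p.τ (j + 1)) {v : Ω → ℝ}
    (hv0 : j = 0 → v ω = 0)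
    (hv : 1 ≤ j → v ω = {ω | (T ω).x i ∈ region p H (T ω) (j + 1)}.indicator
        (fun ω => (T ω).P (j + 1) ((T ω).x i)) ω)
    (hP : 1 ≤ j → ∀ x ∈ region p H (T ω) (j + 1), 0 < (T ω).P (j + 1) x) (g : 𝒳 → Bool) :
    (fun e : 𝒳 × Bool × ℝ => if g e.1 ≠ e.2.1 then e.2.2 else 0)
      ((T ω).addedExample (j + 1) (region p H (T ω) (j + 1)) i) =
    weightedIndicator {ω | g ((T ω).x i) ≠ (T ω).y i} {ω | (T ω).q i = true} v ω := by
  have hy := ht.label i (by omega) (h2.trans (hτ.mono hj le_rfl))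
  rcases Nat.eq_zero_or_pos j with rfl | hj0
  · simp [Trace.addedExample, weightedIndicator, hv0 rfl, Set.indicator_apply]
  have hvj := hv hj0
  by_cases hR : (T ω).x i ∈ region p H (T ω) (j + 1)
  · have hvP : v ω = (T ω).P (j + 1) ((T ω).x i) := by simpa [hR] using hvj
    have hP0 := (hP hj0 _ hR).ne'
    by_cases hq : (T ω).q i = true
    · simp [Trace.addedExample, weightedIndicator, hvP, hP0, hR, hq, hj0.ne', Set.indicator_apply]
    · simp [Trace.addedExample, weightedIndicator, hvP, hP0, hR, hq, hj0.ne', Set.indicator_apply]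
  · have hvP : v ω = 0 := by simpa [hR] using hvj
    have := ht.eq_of_notMem_region hτ hj0 hj.le hR
    simp [Trace.addedExample, weightedIndicator, hvP, hR, hj0.ne', Set.indicator_apply, this, hy]

variable {𝒳 Ω : Type*} [MeasurableSpace 𝒳] {mΩ : MeasurableSpace Ω}

/-- The information consisting of the `i`-th labeled example. -/
abbrev exampleSigma (T : Ω → Trace 𝒳) (i : ℕ) : MeasurableSpace Ω :=
  MeasurableSpace.comap (fun ω => ((T ω).x i, (T ω).y i)) inferInstance

/-- The conditional probability of a query of the `i`-th label given the past and the `i`-th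
labeled example, with value `0` in the first epoch. -/
noncomputable def queryProb (μ : Measure Ω) (ℱ : Filtration ℕ mΩ) (p : Params)
    (T : Ω → Trace 𝒳) (i : ℕ) : Ω → ℝ :=
  if i ≤ p.τ 1 then 0
  else μ[{ω | (T ω).q i = true}.indicator (fun _ => (1 : ℝ)) | ℱ (i - 1) ⊔ exampleSigma T i]

/-- The properties of the query probabilities that hold on almost every realizable trace. -/
structure HasQueryProb (μ : Measure Ω) (ℱ : Filtration ℕ mΩ) (p : Params) (H : Finset (𝒳 → Bool))
    (T : Ω → Trace 𝒳) (ω : Ω) : Prop where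
  eq_indicator : ∀ j, 1 ≤ j → j < p.M → ∀ i, p.τ j < i → i ≤ p.τ (j + 1) →
    queryProb μ ℱ p T i ω = {ω | (T ω).x i ∈ region p H (T ω) (j + 1)}.indicator
      (fun ω => (T ω).P (j + 1) ((T ω).x i)) ω

theorem ae_label_eq {μ : Measure Ω} {ℱ : Filtration ℕ mΩ} {D : Measure (𝒳 × Bool)}
    [IsProbabilityMeasure D] {p : Params} {H : Finset (𝒳 → Bool)} {T : Ω → Trace 𝒳}
    {hstar : 𝒳 → Bool} (realizable : err D hstar = 0) (hT : IsRun μ ℱ D p H T) :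
    ∀ᵐ ω ∂μ, ∀ i, 1 ≤ i → i ≤ p.n → (T ω).y i = hstar ((T ω).x i) := by
  simp only [ae_all_iff]
  intro i h1 h2
  have h : ∀ᵐ z ∂D, hstar z.1 = z.2 := by
    rw [ae_iff]
    exact (measureReal_eq_zero_iff).1 realizable
  rw [← hT.law_xy i h1 h2] at h
  filter_upwards [ae_of_ae_map ((hT.measurable_xy i h1 h2).mono (ℱ.le i) le_rfl).aemeasurable h]
    with ω hω using hω.symm

theorem ae_hasQueryProb {μ : Measure Ω} {ℱ : Filtration ℕ mΩ} {D : Measure (𝒳 × Bool)}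
    {p : Params} (hτ : p.ValidSchedule) {H : Finset (𝒳 → Bool)} {T : Ω → Trace 𝒳}
    (hT : IsRun μ ℱ D p H T) : ∀ᵐ ω ∂μ, HasQueryProb μ ℱ p H T ω := by
  have h : ∀ᵐ ω ∂μ, ∀ j, 1 ≤ j → j < p.M → ∀ i, p.τ j < i → i ≤ p.τ (j + 1) →
      queryProb μ ℱ p T i ω = {ω | (T ω).x i ∈ region p H (T ω) (j + 1)}.indicator
        (fun ω => (T ω).P (j + 1) ((T ω).x i)) ω := by
    simp only [ae_all_iff]
    intro j h1 hj i hi1 hi2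
    have : ¬ i ≤ p.τ 1 := not_le.2 ((hτ.mono h1 hj.le).trans_lt hi1)
    rw [queryProb, if_neg this]
    exact hT.query j h1 hj i hi1 hi2
  filter_upwards [h] with ω hω using ⟨hω⟩

theorem queryProb_of_le (μ : Measure Ω) (ℱ : Filtration ℕ mΩ) {p : Params} (T : Ω → Trace 𝒳)
    {i : ℕ} (hi : i ≤ p.τ 1) : queryProb μ ℱ p T i = 0 := by
  rw [queryProb, if_pos hi]

variable {μ : Measure Ω} {ℱ : Filtration ℕ mΩ} {D : Measure (𝒳 × Bool)} {p : Params}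
  {H : Finset (𝒳 → Bool)} {T : Ω → Trace 𝒳} {hstar : 𝒳 → Bool} {ω : Ω}

theorem le_query_of_mem_region (hτ : p.ValidSchedule) (hc₃ : 1 ≤ p.c₃) (hT : IsRun μ ℱ D p H T)
    (ht : IsRealizable p H hstar (T ω)) {j m : ℕ} (h1 : 1 ≤ j) (hjm : j ≤ m) (hjM : j < p.M)
    (hm : m ≤ p.M) {x : 𝒳} (hx : x ∈ region p H (T ω) (j + 1)) :
    1 / (2 * Real.log (p.τ m)) ≤ (T ω).P (j + 1) x :=
  (ht.le_Pmin hτ hc₃ h1 hjm hm).trans ((hT.solution j h1 hjM ω).1.ge_min x hx)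

/-- The value is 0 in the first epoch and off the disagreement region; elsewhere it is the solution
`P`, which is at least `Pmin`. -/
theorem queryProb_eq_zero_or_le (hτ : p.ValidSchedule) (hc₃ : 1 ≤ p.c₃)
    (hT : IsRun μ ℱ D p H T) (ht : IsRealizable p H hstar (T ω))
    (hq : HasQueryProb μ ℱ p H T ω) {m i : ℕ} (hm : m ≤ p.M) (h0 : 0 < i) (hi : i ≤ p.τ m) :
    queryProb μ ℱ p T i ω = 0 ∨ 1 / (2 * Real.log (p.τ m)) ≤ queryProb μ ℱ p T i ω := by
  obtain ⟨j, hj, hj1, hj2⟩ := hτ.exists_epoch hm h0 hi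
  rcases Nat.eq_zero_or_pos j with rfl | hj0
  · left; rw [queryProb_of_le μ ℱ T hj2]; rfl
  rw [hq.eq_indicator j hj0 (by omega) i hj1 hj2]
  by_cases hR : (T ω).x i ∈ region p H (T ω) (j + 1)
  · right
    simpa [hR] using le_query_of_mem_region hτ hc₃ hT ht hj0 hj.le (by omega) hm hR
  · left; simp [hR]

/-- Removes regions and imputed labels: the right side involves only true examples, query bits and
conditional query probabilities, to which the tail bound applies. -/
theorem empErr_Ztilde_eq (hτ : p.ValidSchedule) (hc₃ : 1 ≤ p.c₃) (hT : IsRun μ ℱ D p H T)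
    (ht : IsRealizable p H hstar (T ω)) (hq : HasQueryProb μ ℱ p H T ω) {m : ℕ} (hm : m ≤ p.M)
    (g : 𝒳 → Bool) :
    empErr g (Ztilde p H (T ω) m) = (∑ i ∈ Finset.range (p.τ m),
      weightedIndicator {ω | g ((T ω).x (i + 1)) ≠ (T ω).y (i + 1)} {ω | (T ω).q (i + 1) = true}
        (queryProb μ ℱ p T (i + 1)) ω) / p.τ m := by
  rw [empErr, card_Ztilde hτ hm]
  congr 1
  refine sum_map_Ztilde hτ (z := fun i => weightedIndicator {ω | g ((T ω).x i) ≠ (T ω).y i}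
    {ω | (T ω).q i = true} (queryProb μ ℱ p T i) ω) hm ?_
  intro j hj i h1 h2
  refine ht.contribution_eq hτ (by omega) h1 h2 ?_
    (fun hj0 => hq.eq_indicator j hj0 (by omega) i h1 h2) (fun hj0 x hx => ?_) g
  · rintro rfl
    rw [queryProb_of_le μ ℱ T h2]; rfl
  · refine lt_of_lt_of_le ?_ (le_query_of_mem_region hτ hc₃ hT ht hj0 hj.le (by omega) hm hx)
    have := hτ.one_lt_log (by omega : 1 ≤ m) hm
    positivity

/-- The event that the importance weighted error of `g` over the first `τ m` examples is at
most `s`. -/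
def lowErrorEvent (μ : Measure Ω) (ℱ : Filtration ℕ mΩ) (p : Params) (T : Ω → Trace 𝒳)
    (m : ℕ) (s : ℝ) (g : 𝒳 → Bool) : Set Ω :=
  {ω | ∑ i ∈ Finset.range (p.τ m),
    weightedIndicator {ω | g ((T ω).x (i + 1)) ≠ (T ω).y (i + 1)} {ω | (T ω).q (i + 1) = true}
      (queryProb μ ℱ p T (i + 1)) ω ≤ s}

/-- The Chernoff bound with `c = 1 / (2 log τ_m)` and `r = err D g`. The intermediate σ-algebra
knows the past and the current example but not its query bit. -/
theorem measure_lowErrorEvent_le [IsProbabilityMeasure μ] [IsProbabilityMeasure D]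
    (hτ : p.ValidSchedule) (hc₃ : 1 ≤ p.c₃) (hT : IsRun μ ℱ D p H T)
    (ht : ∀ᵐ ω ∂μ, IsRealizable p H hstar (T ω)) {g : 𝒳 → Bool} (hg : Measurable g) {m : ℕ}
    (h1 : 1 ≤ m) (hm : m ≤ p.M) (s : ℝ) :
    MeasurableSet (lowErrorEvent μ ℱ p T m s g) ∧
    μ.real (lowErrorEvent μ ℱ p T m s g) ≤
      Real.exp (1 / (2 * Real.log (p.τ m)) * s -
        1 / (2 * Real.log (p.τ m)) / 2 * err D g * p.τ m) := by
  have hlog := hτ.one_lt_log h1 hm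
  have hn : ∀ {i : ℕ}, i + 1 ≤ p.τ m → i + 1 ≤ p.n := fun h => h.trans (hτ.mono hm le_rfl)
  have hmis : MeasurableSet {z : 𝒳 × Bool | g z.1 ≠ z.2} :=
    (measurableSet_eq_fun (hg.comp measurable_fst) measurable_snd).compl
  have hxy : ∀ {i : ℕ}, i + 1 ≤ p.τ m → exampleSigma T (i + 1) ≤ ℱ (i + 1) := fun h =>
    (hT.measurable_xy _ (by omega) (hn h)).comap_le
  refine measure_sum_weightedIndicator_le (k := p.τ m) ℱ (G := fun i => ℱ (i - 1) ⊔ exampleSigma T i)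
    (r := err D g) (𝒜 := exampleSigma T) (A := fun i => {ω | g ((T ω).x i) ≠ (T ω).y i})
    (Q := fun i => {ω | (T ω).q i = true}) (p := queryProb μ ℱ p T)
    (by positivity) ?_ (fun i _ => le_sup_left) (fun i hi => ?_) (fun i _ => le_sup_right)
    (fun i _ => ⟨_, hmis, rfl⟩) (fun i hi => ?_) (fun i hi => ?_) (fun i hi => ?_) (fun i _ => ?_)
    (fun i _ => ?_) (fun i hi => ?_) measureReal_le_one s
  · rw [div_le_one (by positivity)]; linarith
  · exact sup_le (ℱ.mono (by omega)) (hxy hi)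
  · rw [err, ← hT.law_xy (i + 1) (by omega) (hn hi), map_measureReal_apply
      ((hT.measurable_xy (i + 1) (by omega) (hn hi)).mono (ℱ.le _) le_rfl) hmis]
    rfl
  · exact hT.indep_xy (i + 1) (by omega) (hn hi)
  · exact hT.measurable_q (i + 1) (by omega) (hn hi) (measurableSet_singleton true)
  -- `queryProb` is a conditional expectation by definition, so measurability comes for free,
  -- without measurability of the random regions.
  · rw [queryProb]
    split_ifs
    · exact measurable_const
    · exact stronglyMeasurable_condExp.measurable
  · rw [queryProb]
    split_ifs
    · exact Or.inl rfl
    · exact Or.inr rfl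
  · filter_upwards [ht, ae_hasQueryProb hτ hT] with ω h h'
    exact queryProb_eq_zero_or_le hτ hc₃ hT h h' hm (by omega) hi

end Run

end ActiveCover

/-! ### Union bound and conclusion. -/

open ActiveCover
theorem mainTheorem4 {𝒳 Ω : Type*} [MeasurableSpace 𝒳] {mΩ : MeasurableSpace Ω}
    (μ : Measure Ω) [IsProbabilityMeasure μ] (ℱ : Filtration ℕ mΩ)
    (D : Measure (𝒳 × Bool)) [IsProbabilityMeasure D]
    (H : Finset (𝒳 → Bool)) (hH : ∀ g ∈ H, Measurable g)
    (p : Params) (hτ : p.ValidSchedule) (hc : p.ValidConstants H.card)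
    (hδ_pos : 0 < p.δ) (hδ_lt : p.δ < 1 / Real.exp 1) (hHδ : √192 < H.card / p.δ)
    (hstar : 𝒳 → Bool) (hstar_mem : hstar ∈ H) (hstar_min : ∀ g ∈ H, err D hstar ≤ err D g)
    (realizable : err D hstar = 0)
    (T : Ω → Trace 𝒳) (hT : IsRun μ ℱ D p H T) :
    ∃ E : Set Ω, MeasurableSet E ∧ ENNReal.ofReal (1 - p.δ) ≤ μ E ∧
      ∀ ω ∈ E, ∀ m, 1 ≤ m → m ≤ p.M →
        Delta p H (T ω) m = DeltaStar D p H (T ω) hstar m ∧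
        DeltaStar D p H (T ω) hstar m = p.c₂ * p.eps H.card m * Real.log (p.τ m) ∧
        ∀ g ∈ goodSet p H (T ω) (m + 1),
          reg D g hstar ≤ 16 * p.γ * p.c₂ * p.eps H.card m * Real.log (p.τ m) := by
  classical
  have hN0 : 0 < H.card := Finset.card_pos.2 ⟨hstar, hstar_mem⟩
  have hN : 0 ≤ Real.log (H.card / p.δ) :=
    Real.log_nonneg ((Real.one_le_sqrt.2 (by norm_num)).trans hHδ.le)
  have hthr : ∀ m, 1 ≤ m → m ≤ p.M → 0 ≤ p.γ * p.threshold H.card m 0 := by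
    intro m h1 hm
    have := hτ.one_lt_log h1 hm
    have := p.eps_nonneg hN m
    have := hc.one_le_gamma
    have := hc.one_le_c₂
    rw [Params.threshold_zero]
    positivity
  have hreal : ∀ᵐ ω ∂μ, IsRealizable p H hstar (T ω) := by
    filter_upwards [ae_label_eq realizable hT] with ω hω
    exact isRealizable_of_isRun hstar_mem hthr hT hω
  set B : ℕ → ℝ := fun m => p.γ * (p.c₂ * p.eps H.card m * Real.log (p.τ m)) with hB
  -- Which classifiers are bad depends on `D` alone, so the union bound runs over fixed classifiers
  -- although `A_{m+1}` is random.
  let bad : ℕ → Finset (𝒳 → Bool) := fun m => H.filter fun g =>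
    16 * p.γ * p.c₂ * p.eps H.card m * Real.log (p.τ m) < err D g
  let Bad : Set Ω := ⋃ m ∈ Finset.Icc 1 p.M, ⋃ g ∈ bad m, lowErrorEvent μ ℱ p T m (p.τ m * B m) g
  have hBadm : MeasurableSet Bad := by
    refine Finset.measurableSet_biUnion _ fun m hm => Finset.measurableSet_biUnion _ fun g hg => ?_
    rw [Finset.mem_Icc] at hm
    exact (measure_lowErrorEvent_le hτ hc.c₃_ge hT hreal (hH g (Finset.mem_filter.1 hg).1)
      hm.1 hm.2 _).1
  have hBad : μ.real Bad ≤ p.δ := by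
    calc μ.real Bad
        ≤ ∑ m ∈ Finset.Icc 1 p.M, μ.real (⋃ g ∈ bad m, lowErrorEvent μ ℱ p T m (p.τ m * B m) g) :=
          measureReal_biUnion_finset_le _ _
      _ ≤ ∑ m ∈ Finset.Icc 1 p.M, p.δ * ((p.τ m : ℝ) ^ 2)⁻¹ := by
          refine Finset.sum_le_sum fun m hm => ?_
          rw [Finset.mem_Icc] at hm
          have hτm := hτ.add_two_le hm.1 hm.2
          calc μ.real (⋃ g ∈ bad m, lowErrorEvent μ ℱ p T m (p.τ m * B m) g)
              ≤ ∑ g ∈ bad m, μ.real (lowErrorEvent μ ℱ p T m (p.τ m * B m) g) :=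
                measureReal_biUnion_finset_le _ _
            _ ≤ ∑ g ∈ bad m, p.δ / H.card * ((p.τ m : ℝ) ^ 2)⁻¹ := by
                refine Finset.sum_le_sum fun g hg => ?_
                obtain ⟨hgH, hg⟩ := Finset.mem_filter.1 hg
                exact (measure_lowErrorEvent_le hτ hc.c₃_ge hT hreal (hH g hgH) hm.1 hm.2 _).2.trans
                  (exp_tail_le hc hδ_pos hN0 hN (by omega) (hτ.one_lt_log hm.1 hm.2) hg)
            _ ≤ ∑ g ∈ H, p.δ / H.card * ((p.τ m : ℝ) ^ 2)⁻¹ :=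
                Finset.sum_le_sum_of_subset_of_nonneg (Finset.filter_subset _ _)
                  fun _ _ _ => by positivity
            _ = p.δ * ((p.τ m : ℝ) ^ 2)⁻¹ := by
                rw [Finset.sum_const, nsmul_eq_mul]
                field_simp
      _ = p.δ * ∑ m ∈ Finset.Icc 1 p.M, ((p.τ m : ℝ) ^ 2)⁻¹ := by rw [Finset.mul_sum]
      _ ≤ p.δ * 1 := mul_le_mul_of_nonneg_left
          (sum_inv_sq_le fun m h1 hm => hτ.add_two_le h1 hm) hδ_pos.le
      _ = p.δ := mul_one _
  -- The exceptional set is only known to be null, so it is enlarged to a measurable null set.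
  obtain ⟨t, ht, htm, ht0⟩ := exists_measurable_superset_of_null
    (ae_iff.1 (hreal.and (ae_hasQueryProb hτ hT)))
  refine ⟨(Bad ∪ t)ᶜ, (hBadm.union htm).compl, ?_, fun ω hω m h1 hm => ?_⟩
  · rw [← ofReal_measureReal]
    refine ENNReal.ofReal_le_ofReal ?_
    rw [probReal_compl_eq_one_sub (hBadm.union htm)]
    have h0 : μ.real t = 0 := by rw [measureReal_def, ht0]; rfl
    linarith [measureReal_union_le (μ := μ) Bad t]
  rw [Set.mem_compl_iff, Set.mem_union, not_or] at hω
  have hgood : IsRealizable p H hstar (T ω) ∧ HasQueryProb μ ℱ p H T ω :=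
    by_contra fun h => hω.2 (ht h)
  obtain ⟨hr, hq⟩ := hgood
  have hm0 : m ≠ 0 := by omega
  have hemp := ((hr.invariant hτ hm).2.2 h1).2
  -- Each summand is the mass of a subset of the null set where `hstar` errs, whatever the region.
  have havg : errAvg D p H (T ω) m hstar = 0 := by
    rw [errAvg, Finset.sum_eq_zero, mul_zero]
    intro j _
    have : D.real {z | hstar z.1 ≠ z.2 ∧ z.1 ∈ region p H (T ω) j} = 0 :=
      measureReal_mono_null (fun z hz => hz.1) realizable
    rw [this, mul_zero]
  have hDS : DeltaStar D p H (T ω) hstar m = p.c₂ * p.eps H.card m * Real.log (p.τ m) := by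
    simp [DeltaStar, hm0, havg]
  refine ⟨?_, hDS, fun g hg => ?_⟩
  · rw [hDS, Delta, if_neg hm0, hemp, Params.threshold_zero]
  obtain ⟨k, rfl⟩ : ∃ k, m = k + 1 := ⟨m - 1, by omega⟩
  rw [mem_goodSet_succ, hemp, sub_zero, Params.threshold_zero,
    empErr_Ztilde_eq hτ hc.c₃_ge hT hr hq hm] at hg
  have hτm : (0 : ℝ) < p.τ (k + 1) := by
    exact_mod_cast (by have := hτ.add_two_le h1 hm; omega : 0 < p.τ (k + 1))
  rw [reg, realizable, sub_zero]
  -- A good classifier with large regret would be bad and have low weighted error, placing `ω` in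
  -- `Bad`.
  by_contra! hlt
  refine hω.1 (Set.mem_biUnion (Finset.mem_Icc.2 ⟨h1, hm⟩)
    (Set.mem_biUnion (Finset.mem_filter.2 ⟨hg.1, hlt⟩) ?_))
  have := (div_le_iff₀ hτm).1 hg.2
  rw [mul_comm] at this
  exact this
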